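/- All monoids are commutative and cancellative, have a neutral element, and are written additively. A monoid $S$ is torsion-free if $nx=ny$ with $x,y\in S$ and $n\ge 1$ implies $x=y$. An integral domain $R$ with quotient field $F$ is a Krull domain if there is a set $\mathcal V$ of discrete rank-one valuations of $F$ such that $R=\{x\in F : v(x)\ge 0 \text{ for all } v\in\mathcal V\}$ and, for every nonzero $x\in F$, $v(x)=0$ for all but finitely many $v\in\mathcal V$. A monoid $S$ with quotient group $G$ is a Krull monoid if there is a set $\mathcal W$ of nonzero group homomorphisms $w\colon G\to\mathbb Z$ such that $S=\{g\in G : w(g)\ge 0\text{ for all } w\in\mathcal W\}$ and, for every $g\in G$, $w(g)=0$ for all but finitely many $w\in\mathcal W$. (The sets $\mathcal V$ and $\mathcal W$ may be empty.) An abelian group satisfies the ACC on cyclic subgroups if every ascending chain $H_0\subseteq H_1\subseteq\cdots$ of cyclic subgroups becomes stationary. **Proposition (Chouinard's theorem).** Let $D$ be an integral domain and let $S$ be a torsion-free monoid with quotient group $G$. Then the monoid algebra $D[S]$ is a Krull domain if and only if $D$ is a Krull domain, $S$ is a Krull monoid, and $G$ satisfies the ACC on cyclic subgroups. -/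

import Mathlib

open scoped AddMonoidAlgebra WithZero

/-- A Krull domain: an integral domain `R` which is the intersection, inside its quotient field, of
the valuation rings of a set of discrete rank-one valuations (nontrivial valuations with values in
`ℤ`, written multiplicatively and with a zero adjoined) that is of finite character. -/
structure IsKrullDomain (R : Type*) [CommRing R] : Prop where
  isDomain : IsDomain R
  exists_valuations : ∃ V : Set (Valuation (FractionRing R) ℤᵐ⁰),
    (∀ v ∈ V, v.IsNontrivial) ∧
    (∀ x : FractionRing R,
      x ∈ Set.range (algebraMap R (FractionRing R)) ↔ ∀ v ∈ V, v x ≤ 1) ∧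
    (∀ x : FractionRing R, x ≠ 0 → {v ∈ V | v x ≠ 1}.Finite)

/-- A Krull monoid (for an additively written, commutative, cancellative monoid `S`): `S` is the
intersection, inside its quotient group, of the valuation monoids `{g | 0 ≤ w g}` of a set of
discrete rank-one valuations (nonzero homomorphisms to `ℤ`) that is of finite character. -/
def IsKrullAddMonoid (S : Type*) [AddCommMonoid S] [IsCancelAdd S] : Prop :=
  ∃ W : Set (Algebra.GrothendieckAddGroup S →+ ℤ),
    (∀ w ∈ W, w ≠ 0) ∧
    (∀ g : Algebra.GrothendieckAddGroup S,
      g ∈ Set.range (Algebra.GrothendieckAddGroup.of (M := S)) ↔ ∀ w ∈ W, 0 ≤ w g) ∧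
    (∀ g : Algebra.GrothendieckAddGroup S, {w ∈ W | w g ≠ 0}.Finite)

/-- The ascending chain condition on cyclic subgroups. -/
def ACCOnCyclicSubgroups (G : Type*) [AddCommGroup G] : Prop :=
  ∀ H : ℕ → AddSubgroup G, Monotone H → (∀ n, IsAddCyclic (H n)) →
    ∃ n, ∀ m, n ≤ m → H m = H n

namespace AddMonoidAlgebra

/-! Let `K` be the quotient field of `D`. The core of sufficiency is that `K[G]` is factorial when
`G` is torsion-free with ACC on cyclic subgroups. Irreducibles are prime because a relation `p * c =
a * b` lives over a finitely generated, hence free, subgroup, where the algebra is a Laurent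
polynomial ring (`prime_of_irreducible`). Divisor chains stop by a Newton polytope argument
(`wfDvdMonoid`): widths of faces of the support add under multiplication, and ACC bounds from below
the width that a nonunit factor contributes along a line. Divisibility in `D[S]` is then detected by
three families: the primes of `K[G]` give a quotient in `K[G]`, the Gauss extensions of the
valuations of `D` put its coefficients in `D`, and the minima of the weights of `S` put its
exponents in `S`. For necessity, the valuations of `D[S]` are restricted to constants and to
monomials. For ACC, a chain of cyclic subgroups either has a generator of nonzero weight, and
integer divisibility stops it, or its generators `y` all lie in `S`, and the divisors `1 - X^y`
stabilize (`accOnCyclicSubgroups`). -/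

theorem uniqueSums_of_isAddTorsionFree (G : Type*) [AddCommGroup G] [IsAddTorsionFree G] :
    UniqueSums G :=
  have : TwoUniqueSums G := TwoUniqueSums.of_injective_addHom
    (DivisibleHull.coeAddMonoidHom G).toAddHom DivisibleHull.coe_injective inferInstance
  inferInstance

/-! ### Gauss valuations on group algebras. -/

section Gauss

variable {K G Γ₀ : Type*} [Field K] [AddCommGroup G] [LinearOrderedCommGroupWithZero Γ₀]

/-- The function underlying the generalized Gauss valuation. -/
noncomputable def gaussFun (v : Valuation K Γ₀) (μ : Multiplicative G →* Γ₀) (f : K[G]) : Γ₀ :=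
  f.coeff.support.sup fun g ↦ v (f.coeff g) * μ (.ofAdd g)

variable (v : Valuation K Γ₀) (μ : Multiplicative G →* Γ₀)

theorem gaussFun_le_iff {f : K[G]} {γ : Γ₀} :
    gaussFun v μ f ≤ γ ↔ ∀ g, v (f.coeff g) * μ (.ofAdd g) ≤ γ := by
  rw [gaussFun, Finset.sup_le_iff]
  refine ⟨fun h g ↦ ?_, fun h g _ ↦ h g⟩
  by_cases hg : g ∈ f.coeff.support
  · exact h g hg
  · simp [Finsupp.notMem_support_iff.1 hg]

theorem le_gaussFun (f : K[G]) (g : G) : v (f.coeff g) * μ (.ofAdd g) ≤ gaussFun v μ f :=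
  (gaussFun_le_iff v μ).1 le_rfl g

theorem exists_gaussFun_eq {f : K[G]} (hf : f ≠ 0) :
    ∃ g ∈ f.coeff.support, gaussFun v μ f = v (f.coeff g) * μ (.ofAdd g) :=
  Finset.exists_mem_eq_sup _ (Finsupp.support_nonempty_iff.2 (by simpa using hf)) _

theorem gaussFun_zero : gaussFun v μ 0 = 0 := by
  rw [← le_zero_iff, gaussFun_le_iff]; simp

theorem gaussFun_ne_zero {f : K[G]} (hf : f ≠ 0) : gaussFun v μ f ≠ 0 := by
  obtain ⟨g, hg, h⟩ := exists_gaussFun_eq v μ hf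
  rw [h]
  exact mul_ne_zero ((Valuation.ne_zero_iff v).2 (Finsupp.mem_support_iff.1 hg))
    ((Group.isUnit (Multiplicative.ofAdd g)).map μ).ne_zero

/-- Unique sums replace an order on `G`. Among the exponents of `x` and of `y` attaining their
maxima some `a + b` is uniquely represented, so in the coefficient of the product at `a + b` one
term strictly dominates and cannot cancel. -/
theorem gaussFun_mul [UniqueSums G] (x y : K[G]) :
    gaussFun v μ (x * y) = gaussFun v μ x * gaussFun v μ y := by
  classical
  rcases eq_or_ne x 0 with rfl | hx
  · simp [gaussFun_zero]
  rcases eq_or_ne y 0 with rfl | hy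
  · simp [gaussFun_zero]
  have key (a g : G) : v (x.coeff a * y.coeff (-a + g)) * μ (.ofAdd g) =
      (v (x.coeff a) * μ (.ofAdd a)) * (v (y.coeff (-a + g)) * μ (.ofAdd (-a + g))) := by
    have : Multiplicative.ofAdd g = .ofAdd a * .ofAdd (-a + g) := by
      rw [← ofAdd_add, add_neg_cancel_left]
    rw [map_mul, this, map_mul]
    ac_rfl
  have μ0 (g : G) : 0 < μ (.ofAdd g) :=
    zero_lt_iff.2 ((Group.isUnit (Multiplicative.ofAdd g)).map μ).ne_zero
  apply le_antisymm
  · rw [gaussFun_le_iff]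
    intro g
    rw [coeff_mul_apply_left, Finsupp.sum, ← le_div_iff₀ (μ0 g)]
    refine v.map_sum_le fun a _ ↦ ?_
    rw [le_div_iff₀ (μ0 g), key]
    exact mul_le_mul' (le_gaussFun v μ x a) (le_gaussFun v μ y _)
  · have hA (f : K[G]) (hf : f ≠ 0) : (f.coeff.support.filter fun g ↦
        gaussFun v μ f = v (f.coeff g) * μ (.ofAdd g)).Nonempty := by
      obtain ⟨g, hg, h⟩ := exists_gaussFun_eq v μ hf
      exact ⟨g, Finset.mem_filter.2 ⟨hg, h⟩⟩
    obtain ⟨a, ha, b, hb, hab⟩ := UniqueSums.uniqueAdd_of_nonempty (hA x hx) (hA y hy)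
    have hMN : gaussFun v μ x * gaussFun v μ y ≠ 0 :=
      mul_ne_zero (gaussFun_ne_zero v μ hx) (gaussFun_ne_zero v μ hy)
    rw [Finset.mem_filter] at ha hb
    refine le_trans (le_of_eq ?_) (le_gaussFun v μ (x * y) (a + b))
    rw [coeff_mul_apply_left, Finsupp.sum, ← Finset.add_sum_erase _ _ ha.1]
    have e : v (x.coeff a * y.coeff (-a + (a + b))) =
        gaussFun v μ x * gaussFun v μ y / μ (.ofAdd (a + b)) := by
      rw [eq_div_iff (μ0 _).ne', key, neg_add_cancel_left, ha.2, hb.2]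
    have hne : gaussFun v μ x * gaussFun v μ y / μ (.ofAdd (a + b)) ≠ 0 :=
      div_ne_zero hMN (μ0 _).ne'
    rw [v.map_add_eq_of_lt_left, e, div_mul_cancel₀ _ (μ0 _).ne']
    rw [e]
    refine v.map_sum_lt hne fun c hc ↦ ?_
    rw [lt_div_iff₀ (μ0 _), key]
    refine lt_of_le_of_ne (mul_le_mul' (le_gaussFun v μ x c) (le_gaussFun v μ y _)) fun h ↦ ?_
    have hx0 := (gaussFun_ne_zero v μ hx)
    have hy0 := (gaussFun_ne_zero v μ hy)
    have h1 : gaussFun v μ x = v (x.coeff c) * μ (.ofAdd c) := by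
      refine le_antisymm (not_lt.1 fun hlt ↦ ?_) (le_gaussFun v μ x c)
      exact ((mul_le_mul' le_rfl (le_gaussFun v μ y _)).trans_lt
        (mul_lt_mul_of_pos_right hlt (zero_lt_iff.2 hy0))).ne h
    have h2 : gaussFun v μ y =
        v (y.coeff (-c + (a + b))) * μ (.ofAdd (-c + (a + b))) := by
      rw [h1] at h
      exact (mul_left_cancel₀ (h1 ▸ hx0) h).symm
    have hcy : -c + (a + b) ∈ y.coeff.support := by
      rw [Finsupp.mem_support_iff]
      intro h0
      rw [h0, map_zero, zero_mul] at h2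
      exact hy0 h2
    exact (Finset.mem_erase.1 hc).1 (hab (Finset.mem_filter.2 ⟨(Finset.mem_erase.1 hc).2, h1⟩)
      (Finset.mem_filter.2 ⟨hcy, h2⟩) (by abel)).1

/-- The generalized Gauss valuation `∑ a_g X^g ↦ max (v a_g * μ g)` on a group algebra over a valued
field. -/
noncomputable def gaussValuation [UniqueSums G] : Valuation K[G] Γ₀ where
  toFun := gaussFun v μ
  map_zero' := gaussFun_zero v μ
  map_one' := by
    classical
    apply le_antisymm
    · rw [gaussFun_le_iff]
      intro g
      rw [one_def, coeff_single, Finsupp.single_apply]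
      split_ifs with h
      · subst h; simp
      · simp
    · have := le_gaussFun v μ 1 0
      simpa [one_def] using this
  map_mul' := gaussFun_mul v μ
  map_add_le_max' x y := by
    rw [gaussFun_le_iff]
    intro g
    rw [coeff_add, Finsupp.add_apply]
    refine (mul_le_mul_left (v.map_add _ _) _).trans ?_
    rw [max_mul]
    exact max_le_max (le_gaussFun v μ x g) (le_gaussFun v μ y g)

variable [UniqueSums G]

theorem gaussValuation_le_iff {f : K[G]} {γ : Γ₀} :
    gaussValuation v μ f ≤ γ ↔ ∀ g, v (f.coeff g) * μ (.ofAdd g) ≤ γ :=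
  gaussFun_le_iff v μ

theorem exists_gaussValuation_eq {f : K[G]} (hf : f ≠ 0) :
    ∃ g ∈ f.coeff.support, gaussValuation v μ f = v (f.coeff g) * μ (.ofAdd g) :=
  exists_gaussFun_eq v μ hf

theorem le_gaussValuation (f : K[G]) (g : G) :
    v (f.coeff g) * μ (.ofAdd g) ≤ gaussValuation v μ f :=
  le_gaussFun v μ f g

theorem gaussValuation_ne_zero {f : K[G]} (hf : f ≠ 0) : gaussValuation v μ f ≠ 0 :=
  gaussFun_ne_zero v μ hf

end Gauss

/-! ### Maxima of homomorphisms on supports, from the trivial valuation of the coefficients. -/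

section TopValue

variable {K G Γ : Type*} [Field K] [AddCommGroup G] [UniqueSums G]
  [AddCommGroup Γ] [LinearOrder Γ] [IsOrderedAddMonoid Γ]

/-- The homomorphism `X^g ↦ exp (α g)`. -/
def expHom {G Γ : Type*} [AddCommGroup G] [AddCommGroup Γ] (α : G →+ Γ) :
    Multiplicative G →* Γᵐ⁰ where
  toFun g := WithZero.exp (α g.toAdd)
  map_one' := by simp
  map_mul' a b := by simp [WithZero.exp_add]

@[simp]
theorem expHom_apply {G Γ : Type*} [AddCommGroup G] [AddCommGroup Γ] (α : G →+ Γ) (g : G) :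
    expHom α (.ofAdd g) = WithZero.exp (α g) := rfl

open Classical in
/-- The maximal value of `α` on the support of `f` (for `f ≠ 0`). -/
noncomputable def topValue (α : G →+ Γ) (f : K[G]) : Γ :=
  (gaussValuation (1 : Valuation K Γᵐ⁰) (expHom α) f).log

theorem topValue_mul (α : G →+ Γ) {f h : K[G]} (hf : f ≠ 0) (hh : h ≠ 0) :
    topValue α (f * h) = topValue α f + topValue α h := by
  classical
  rw [topValue, map_mul, WithZero.log_mul (gaussValuation_ne_zero _ _ hf)
    (gaussValuation_ne_zero _ _ hh)]
  rfl

theorem exists_topValue_eq (α : G →+ Γ) {f : K[G]} (hf : f ≠ 0) :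
    ∃ g ∈ f.coeff.support, topValue α f = α g := by
  classical
  obtain ⟨g, hg, h⟩ := exists_gaussValuation_eq (1 : Valuation K Γᵐ⁰) (expHom α) hf
  refine ⟨g, hg, ?_⟩
  rw [Valuation.one_apply_of_ne_zero (Finsupp.mem_support_iff.1 hg), one_mul] at h
  rw [topValue, h, expHom_apply, WithZero.log_exp]

theorem le_topValue (α : G →+ Γ) {f : K[G]} {g : G} (hg : g ∈ f.coeff.support) :
    α g ≤ topValue α f := by
  classical
  have hf : f ≠ 0 := by rintro rfl; simp at hg
  have h := le_gaussValuation (1 : Valuation K Γᵐ⁰) (expHom α) f g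
  rw [Valuation.one_apply_of_ne_zero (Finsupp.mem_support_iff.1 hg), one_mul, expHom_apply] at h
  rw [topValue, ← WithZero.exp_le_exp, WithZero.exp_log (gaussValuation_ne_zero _ _ hf)]
  exact h

end TopValue
end AddMonoidAlgebra

/-! ### Faces of finite subsets of a torsion-free group. -/

section Convex

variable {G : Type*} [AddCommGroup G]

/-- In the divisible hull, a rational vector space, one functional can avoid vanishing on the
finitely many nonzero differences of points of `A`. -/
theorem exists_addMonoidHom_rat_injOn [IsAddTorsionFree G] (A : Finset G) :
    ∃ ψ : G →+ ℚ, Set.InjOn ψ A := by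
  classical
  let ι := {x : G × G // x ∈ A ×ˢ A ∧ x.1 ≠ x.2}
  have : Finite ι := Set.Finite.subset (A ×ˢ A).finite_toSet (fun x hx ↦ hx.1)
  obtain ⟨F, hF⟩ := Module.exists_dual_forall_apply_ne_zero (K := ℚ) (M := DivisibleHull G)
    (fun i : ι ↦ DivisibleHull.coeAddMonoidHom G (i.1.1 - i.1.2)) fun i h ↦
      i.2.2 (sub_eq_zero.1 ((injective_iff_map_eq_zero (DivisibleHull.coeAddMonoidHom G)).1
        DivisibleHull.coe_injective _ h))
  refine ⟨F.toAddMonoidHom.comp (DivisibleHull.coeAddMonoidHom G), fun x hx y hy hxy ↦ ?_⟩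
  by_contra hne
  refine hF ⟨(x, y), Finset.mem_product.2 ⟨hx, hy⟩, hne⟩ ?_
  rw [map_sub, map_sub, sub_eq_zero]
  exact hxy

theorem exists_addMonoidHom_rat_ne [IsAddTorsionFree G] {x y : G} (h : x ≠ y) :
    ∃ ψ : G →+ ℚ, ψ x ≠ ψ y := by
  classical
  obtain ⟨ψ, hψ⟩ := exists_addMonoidHom_rat_injOn ({x, y} : Finset G)
  exact ⟨ψ, fun e ↦ h (hψ (by simp) (by simp) e)⟩

/-- By duality `x` lies on the rational line through `c` in the divisible hull; clearing the
denominator gives the relation. -/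
theorem exists_zsmul_eq_zsmul_of_forall_addMonoidHom_rat [IsAddTorsionFree G] {c x : G}
    (h : ∀ χ : G →+ ℚ, χ c = 0 → χ x = 0) : ∃ n m : ℤ, n ≠ 0 ∧ n • x = m • c := by
  let i := DivisibleHull.coeAddMonoidHom G
  have hx : i x ∈ Submodule.span ℚ {i c} := by
    by_contra hx
    obtain ⟨F, hF, hF'⟩ := Submodule.exists_le_ker_of_notMem hx
    refine hF (h (F.toAddMonoidHom.comp i) ?_)
    exact hF' (Submodule.mem_span_singleton_self _)
  obtain ⟨q, hq⟩ := Submodule.mem_span_singleton.1 hx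
  refine ⟨q.den, q.num, by simp, DivisibleHull.coe_injective ?_⟩
  change i _ = i _
  rw [map_zsmul, map_zsmul, ← hq, ← Int.cast_smul_eq_zsmul ℚ, ← Int.cast_smul_eq_zsmul ℚ, smul_smul,
    Int.cast_natCast, Rat.den_mul_eq_num]

/-- The points of `A` where `φ` is maximal. -/
def maxFace (φ : G →+ ℚ) (A : Finset G) : Finset G :=
  A.filter fun g ↦ ∀ h ∈ A, φ h ≤ φ g

theorem mem_maxFace {φ : G →+ ℚ} {A : Finset G} {g : G} :
    g ∈ maxFace φ A ↔ g ∈ A ∧ ∀ h ∈ A, φ h ≤ φ g :=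
  Finset.mem_filter

theorem eq_of_mem_maxFace {φ : G →+ ℚ} {A : Finset G} {g h : G} (hg : g ∈ maxFace φ A)
    (hh : h ∈ maxFace φ A) : φ g = φ h :=
  le_antisymm ((mem_maxFace.1 hh).2 _ (mem_maxFace.1 hg).1)
    ((mem_maxFace.1 hg).2 _ (mem_maxFace.1 hh).1)

theorem lt_of_notMem_maxFace {φ : G →+ ℚ} {A : Finset G} {g h : G} (hg : g ∈ maxFace φ A)
    (hh : h ∈ A) (hh' : h ∉ maxFace φ A) : φ h < φ g := by
  refine lt_of_le_of_ne ((mem_maxFace.1 hg).2 _ hh) fun e ↦ hh' (mem_maxFace.2 ⟨hh, ?_⟩)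
  rw [e]
  exact (mem_maxFace.1 hg).2

theorem eventually_add_nsmul_lt {φ θ : G →+ ℚ} {x u : G} (h : φ x < φ u) :
    ∀ᶠ N : ℕ in Filter.atTop, (θ + N • φ) x < (θ + N • φ) u := by
  obtain ⟨N₀, hN₀⟩ := exists_nat_gt ((θ x - θ u) / (φ u - φ x))
  filter_upwards [Filter.eventually_ge_atTop N₀] with N hN
  have h1 : (θ x - θ u) / (φ u - φ x) < N := hN₀.trans_le (by exact_mod_cast hN)
  rw [div_lt_iff₀ (sub_pos.2 h)] at h1
  simp only [AddMonoidHom.add_apply, AddMonoidHom.nsmul_apply, nsmul_eq_mul]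
  linarith

/-- For large `N` the term `N • φ` dominates, and `θ` only breaks ties inside the `φ`-face. -/
theorem eventually_maxFace_add_nsmul (φ θ : G →+ ℚ) {A : Finset G} {u : G} (hu : u ∈ maxFace φ A)
    (hθ : ∀ x ∈ maxFace φ A, θ x ≤ θ u) :
    ∀ᶠ N : ℕ in Filter.atTop, ∀ x, x ∈ maxFace (θ + N • φ) A ↔ x ∈ maxFace φ A ∧ θ x = θ u := by
  have : ∀ᶠ N : ℕ in Filter.atTop, ∀ x ∈ A, x ∉ maxFace φ A →
      (θ + N • φ) x < (θ + N • φ) u := by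
    rw [Filter.eventually_all_finset]
    intro x hx
    by_cases hxF : x ∈ maxFace φ A
    · exact Filter.Eventually.of_forall fun N h ↦ absurd hxF h
    · filter_upwards [eventually_add_nsmul_lt (lt_of_notMem_maxFace hu hx hxF)] with N hN _ using hN
  filter_upwards [this] with N hN x
  have hval {y : G} (hy : y ∈ maxFace φ A) :
      (θ + N • φ) u - (θ + N • φ) y = θ u - θ y := by
    simp [eq_of_mem_maxFace hu hy]
  constructor
  · intro hx
    obtain ⟨hxA, hx⟩ := mem_maxFace.1 hx
    have h1 := hx u (mem_maxFace.1 hu).1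
    have hxF : x ∈ maxFace φ A := by
      by_contra hxF
      exact absurd (hN x hxA hxF) h1.not_gt
    exact ⟨hxF, le_antisymm (hθ x hxF) (by linarith [hval hxF])⟩
  · rintro ⟨hxF, hx⟩
    refine mem_maxFace.2 ⟨(mem_maxFace.1 hxF).1, fun y hy ↦ ?_⟩
    have h1 := hval hxF
    by_cases hyF : y ∈ maxFace φ A
    · linarith [hval hyF, hθ y hyF]
    · linarith [hN y hy hyF]

/-- A finite set `A` with at least two points has a face with at least two points, in a direction
where a second finite set `B` has a face contained in a line. -/
theorem exists_maxFace_collinear [IsAddTorsionFree G] {A : Finset G} (hA : 1 < A.card)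
    (B : Finset G) :
    ∃ φ : G →+ ℚ, 1 < (maxFace φ A).card ∧ ∀ p ∈ maxFace φ B, ∀ q ∈ maxFace φ B,
      ∀ r ∈ maxFace φ B, p ≠ q → ∀ χ : G →+ ℚ, χ p = χ q → χ r = χ p := by
  classical
  -- Among admissible directions (zero is one) choose `φ` with the fewest points in the face of `B`.
  -- If that face is not collinear, a tilt of `φ` will shrink it while keeping two points in the
  -- face of `A`.
  have hex : ∃ n, ∃ φ : G →+ ℚ, 1 < (maxFace φ A).card ∧ (maxFace φ B).card = n :=
    ⟨_, 0, by simpa [maxFace] using hA, rfl⟩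
  obtain ⟨φ, hφA, hφB⟩ := Nat.find_spec hex
  refine ⟨φ, hφA, fun p hp q hq r hr hpq χ hχ ↦ ?_⟩
  by_contra hrp
  obtain ⟨ψ, hψ⟩ := exists_addMonoidHom_rat_injOn (A ∪ B)
  have hFA : ∀ x ∈ maxFace φ A, x ∈ A ∪ B := fun x hx ↦
    Finset.mem_union_left _ (mem_maxFace.1 hx).1
  have hFB : ∀ x ∈ maxFace φ B, x ∈ A ∪ B := fun x hx ↦
    Finset.mem_union_right _ (mem_maxFace.1 hx).1
  obtain ⟨u, hu, hmax⟩ := Finset.exists_max_image (maxFace φ A) ψ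
    (Finset.card_pos.1 (by omega))
  have hlt : ∀ s ∈ (maxFace φ A).erase u, 0 < ψ u - ψ s := fun s hs ↦ by
    rw [Finset.mem_erase] at hs
    exact sub_pos.2 (lt_of_le_of_ne (hmax s hs.2) fun e ↦ hs.1 (hψ (hFA s hs.2) (hFA u hu) e))
  obtain ⟨s, hs, hsmax⟩ := Finset.exists_max_image ((maxFace φ A).erase u)
    (fun s ↦ (χ s - χ u) / (ψ u - ψ s))
    (Finset.card_pos.1 (by rw [Finset.card_erase_of_mem hu]; omega))
  -- The critical slope: `χ + m ψ` is maximal on the face of `A` at `u`, with a tie at `s`.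
  set m := (χ s - χ u) / (ψ u - ψ s) with hm
  let θ : G →+ ℚ := χ + (AddMonoidHom.mulLeft m).comp ψ
  have hθ (x : G) : θ x = χ x + m * ψ x := rfl
  have hθu : ∀ x ∈ maxFace φ A, θ x ≤ θ u := by
    intro x hx
    rcases eq_or_ne x u with rfl | hxu
    · rfl
    have hx' := Finset.mem_erase.2 ⟨hxu, hx⟩
    have := hsmax x hx'
    rw [div_le_iff₀ (hlt x hx')] at this
    rw [hθ, hθ]
    linarith
  have hθs : θ s = θ u := by
    rw [eq_div_iff (hlt s hs).ne'] at hm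
    rw [hθ, hθ]
    linarith
  obtain ⟨b, hb, hbmax⟩ := Finset.exists_max_image (maxFace φ B) θ ⟨p, hp⟩
  obtain ⟨N, hN, hN'⟩ := ((eventually_maxFace_add_nsmul φ θ hu hθu).and
    (eventually_maxFace_add_nsmul φ θ hb hbmax)).exists
  refine Nat.find_min hex (m := (maxFace (θ + N • φ) B).card) ?_ ⟨_, ?_, rfl⟩
  · rw [← hφB]
    refine Finset.card_lt_card (Finset.ssubset_iff_of_subset (fun x hx ↦ ((hN' x).1 hx).1) |>.2 ?_)
    by_contra! hcon
    -- If the tilt removed nothing, `θ` would be constant on the face of `B`. Since `χ p = χ q`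
    -- while `ψ` separates `p` and `q`, this forces `m = 0`, and then `χ r = χ p`.
    have hc : ∀ x ∈ maxFace φ B, θ x = θ b := fun x hx ↦ ((hN' x).1 (hcon x hx)).2
    have hpq' := (hc p hp).trans (hc q hq).symm
    have hpr' := (hc p hp).trans (hc r hr).symm
    rw [hθ, hθ, hχ, add_right_inj, mul_eq_mul_left_iff] at hpq'
    rcases hpq' with h | h
    · exact hpq (hψ (hFB p hp) (hFB q hq) h)
    · rw [hθ, hθ, h, zero_mul, zero_mul, add_zero, add_zero] at hpr'
      exact hrp hpr'.symm
  · rw [Finset.one_lt_card]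
    exact ⟨u, (hN u).2 ⟨hu, rfl⟩, s, (hN s).2 ⟨(Finset.mem_erase.1 hs).2, hθs⟩,
      (Finset.mem_erase.1 hs).1.symm⟩

end Convex

/-! ### Additivity of face widths and the divisor chain condition. -/

namespace AddMonoidAlgebra

section Width

variable {K G : Type*} [Field K] [AddCommGroup G] [UniqueSums G]

/-- The homomorphism `(φ, χ)` to the lexicographic product. -/
def lexHom {G : Type*} [AddCommGroup G] (φ χ : G →+ ℚ) : G →+ ℚ ×ₗ ℚ where
  toFun g := toLex (φ g, χ g)
  map_zero' := by simp
  map_add' a b := by simp [← toLex_add]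

/-- The maximum of `χ` on the points of the support of `f` where `φ` is maximal. -/
noncomputable def faceTop (φ χ : G →+ ℚ) (f : K[G]) : ℚ :=
  (ofLex (topValue (lexHom φ χ) f)).2

theorem faceTop_mul (φ χ : G →+ ℚ) {f h : K[G]} (hf : f ≠ 0) (hh : h ≠ 0) :
    faceTop φ χ (f * h) = faceTop φ χ f + faceTop φ χ h := by
  rw [faceTop, topValue_mul _ hf hh]
  rfl

theorem exists_faceTop_eq (φ χ : G →+ ℚ) {f : K[G]} (hf : f ≠ 0) :
    ∃ g ∈ maxFace φ f.coeff.support, faceTop φ χ f = χ g := by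
  obtain ⟨g, hg, h⟩ := exists_topValue_eq (lexHom φ χ) hf
  refine ⟨g, mem_maxFace.2 ⟨hg, fun x hx ↦ ?_⟩, by rw [faceTop, h]; rfl⟩
  have := le_topValue (lexHom φ χ) hx
  rw [h] at this
  exact Prod.Lex.monotone_fst _ _ this

theorem le_faceTop {φ χ : G →+ ℚ} {f : K[G]} {x : G} (hx : x ∈ maxFace φ f.coeff.support) :
    χ x ≤ faceTop φ χ f := by
  have hf : f ≠ 0 := by rintro rfl; simp [maxFace] at hx
  obtain ⟨g, hg, h⟩ := exists_topValue_eq (lexHom φ χ) hf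
  have := le_topValue (lexHom φ χ) (mem_maxFace.1 hx).1
  rw [faceTop, h]
  rw [h] at this
  rcases (Prod.Lex.le_iff).1 this with h1 | h1
  · exact absurd ((mem_maxFace.1 hx).2 g hg) (not_le.2 h1)
  · exact h1.2

/-- The width with respect to `χ` of the set of points of the support of `f` where `φ` is
maximal. -/
noncomputable def faceWidth (φ χ : G →+ ℚ) (f : K[G]) : ℚ :=
  faceTop φ χ f + faceTop φ (-χ) f

theorem faceWidth_mul (φ χ : G →+ ℚ) {f h : K[G]} (hf : f ≠ 0) (hh : h ≠ 0) :
    faceWidth φ χ (f * h) = faceWidth φ χ f + faceWidth φ χ h := by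
  rw [faceWidth, faceTop_mul _ _ hf hh, faceTop_mul _ _ hf hh, faceWidth, faceWidth]
  ring

theorem sub_le_faceWidth {φ χ : G →+ ℚ} {f : K[G]} {x y : G}
    (hx : x ∈ maxFace φ f.coeff.support) (hy : y ∈ maxFace φ f.coeff.support) :
    χ x - χ y ≤ faceWidth φ χ f := by
  have h1 := le_faceTop (χ := χ) hx
  have h2 := le_faceTop (χ := -χ) hy
  rw [AddMonoidHom.neg_apply] at h2
  rw [faceWidth]
  linarith

theorem faceWidth_nonneg (φ χ : G →+ ℚ) {f : K[G]} (hf : f ≠ 0) : 0 ≤ faceWidth φ χ f := by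
  obtain ⟨x, hx, -⟩ := exists_faceTop_eq φ χ hf
  simpa using sub_le_faceWidth (χ := χ) hx hx

theorem faceWidth_eq_zero {φ χ : G →+ ℚ} {f : K[G]} (hf : f ≠ 0)
    (h : ∀ x ∈ maxFace φ f.coeff.support, ∀ y ∈ maxFace φ f.coeff.support, χ x = χ y) :
    faceWidth φ χ f = 0 := by
  obtain ⟨x, hx, hx'⟩ := exists_faceTop_eq φ χ hf
  obtain ⟨y, hy, hy'⟩ := exists_faceTop_eq φ (-χ) hf
  rw [faceWidth, hx', hy', AddMonoidHom.neg_apply, h x hx y hy, add_neg_cancel]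

/-- Widths are nonnegative and additive, so a factor of an element of width zero has width zero. -/
theorem eq_of_mem_maxFace_of_dvd {φ χ : G →+ ℚ} {f b : K[G]} (hf : f ≠ 0) (hb : b ∣ f)
    (h : ∀ x ∈ maxFace φ f.coeff.support, ∀ y ∈ maxFace φ f.coeff.support, χ x = χ y) {x y : G}
    (hx : x ∈ maxFace φ b.coeff.support) (hy : y ∈ maxFace φ b.coeff.support) : χ x = χ y := by
  obtain ⟨c, rfl⟩ := hb
  have hb0 := left_ne_zero_of_mul hf
  have hc0 := right_ne_zero_of_mul hf
  have h0 := faceWidth_eq_zero hf h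
  rw [faceWidth_mul _ _ hb0 hc0] at h0
  have := faceWidth_nonneg φ χ hc0
  linarith [sub_le_faceWidth (χ := χ) hx hy, sub_le_faceWidth (χ := χ) hy hx]

/-- The maximum of `φ` on the support minus its minimum on the `ψ`-face is nonnegative, additive
under products, and zero exactly when the `ψ`-face lies in the `φ`-face. It vanishes for `f`, hence
for `b`. -/
theorem maxFace_subset_of_dvd {φ ψ : G →+ ℚ} {f b : K[G]} (hf : f ≠ 0) (hb : b ∣ f)
    (h : maxFace φ f.coeff.support = maxFace ψ f.coeff.support) :
    maxFace ψ b.coeff.support ⊆ maxFace φ b.coeff.support := by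
  obtain ⟨c, rfl⟩ := hb
  have hb0 := left_ne_zero_of_mul hf
  have hc0 := right_ne_zero_of_mul hf
  have hnn (g : K[G]) (hg : g ≠ 0) : 0 ≤ faceTop ψ (-φ) g + topValue φ g := by
    obtain ⟨x, hx, hx'⟩ := exists_faceTop_eq ψ (-φ) hg
    have := le_topValue φ (mem_maxFace.1 hx).1
    rw [hx', AddMonoidHom.neg_apply]
    linarith
  have h0 : faceTop ψ (-φ) (b * c) + topValue φ (b * c) = 0 := by
    obtain ⟨x, hx, hx'⟩ := exists_faceTop_eq ψ (-φ) hf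
    obtain ⟨y, hy, hy'⟩ := exists_topValue_eq φ hf
    rw [← h] at hx
    rw [hx', hy', AddMonoidHom.neg_apply, neg_add_eq_zero]
    refine le_antisymm ?_ ((mem_maxFace.1 hx).2 y hy)
    rw [← hy']
    exact le_topValue φ (mem_maxFace.1 hx).1
  rw [faceTop_mul _ _ hb0 hc0, topValue_mul _ hb0 hc0] at h0
  have hb1 := hnn b hb0
  have hc1 := hnn c hc0
  intro y hy
  refine mem_maxFace.2 ⟨(mem_maxFace.1 hy).1, fun z hz ↦ ?_⟩
  have h1 := le_faceTop (χ := -φ) hy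
  have h2 := le_topValue φ hz
  rw [AddMonoidHom.neg_apply] at h1
  linarith

end Width

theorem isUnit_single {K G : Type*} [Field K] [AddCommGroup G] (g : G) {r : K} (hr : r ≠ 0) :
    IsUnit (single g r : K[G]) :=
  IsUnit.of_mul_eq_one (single (-g) r⁻¹) (by simp [single_mul_single, hr, one_def])

theorem one_lt_card_support {K G : Type*} [Field K] [AddCommGroup G] {b : K[G]} (hb0 : b ≠ 0)
    (hb : ¬ IsUnit b) : 1 < b.coeff.support.card := by
  by_contra! h
  obtain ⟨g, hg⟩ := (Finsupp.card_support_le_one (f := b.coeff)).1 h |>.imp fun _ h ↦ h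
  have e : b = single g (b.coeff g) := by
    rw [← coeff_inj, coeff_single]; exact hg
  refine hb (e ▸ isUnit_single g fun h0 ↦ hb0 ?_)
  rw [e, h0, single_zero]

/-- Each nonunit quotient `b n` has a face with two points in a direction where the face of `a 0` is
collinear. Infinitely many `n` share one face of `a 0`, so those faces of `b n` are parallel to one
line, on which `hG` makes all differences multiples of a fixed `c₀`. Each such `b n` thus uses up a
fixed amount of the finite width of `a 0`. -/
theorem wfDvdMonoid {K G : Type*} [Field K] [AddCommGroup G] [IsAddTorsionFree G]
    (hG : ∀ c : G, c ≠ 0 → ∃ c₀ : G, c₀ ≠ 0 ∧ ∀ x : G, ∀ n m : ℤ, n ≠ 0 → n • x = m • c →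
      x ∈ AddSubgroup.zmultiples c₀) : WfDvdMonoid K[G] := by
  classical
  have : UniqueSums G := uniqueSums_of_isAddTorsionFree G
  refine ⟨wellFounded_iff_isEmpty_descending_chain.2 ⟨fun ⟨a', ha'⟩ ↦ ?_⟩⟩
  -- The shift is needed because `a' 0` may be zero.
  let a (n : ℕ) := a' (n + 1)
  have ha0 (n : ℕ) : a n ≠ 0 := (ha' n).1
  choose b hbu hb using fun n ↦ (ha' (n + 1)).2
  replace hb (n : ℕ) : a n = a (n + 1) * b n := hb n
  have hb0 (n : ℕ) : b n ≠ 0 := fun h ↦ ha0 n (by rw [hb, h, mul_zero])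
  have hdvd (n : ℕ) : a n ∣ a 0 := by
    induction n with
    | zero => exact dvd_rfl
    | succ n ih => exact (Dvd.intro _ (hb n).symm).trans ih
  have hbdvd (n : ℕ) : b n ∣ a 0 := (Dvd.intro_left _ (hb n).symm).trans (hdvd n)
  choose φ hφ hφ' using fun n ↦ exists_maxFace_collinear (one_lt_card_support (hb0 n) (hbu n))
    (a 0).coeff.support
  let E (n : ℕ) : (a 0).coeff.support.powerset :=
    ⟨maxFace (φ n) (a 0).coeff.support, Finset.mem_powerset.2 (Finset.filter_subset _ _)⟩
  -- Pigeonhole: the support of `a 0` has only finitely many faces.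
  obtain ⟨E₀, hE₀⟩ := Finite.exists_infinite_fiber E
  have hinf : (E ⁻¹' {E₀}).Infinite := Set.infinite_coe_iff.1 hE₀
  obtain ⟨i, hi⟩ := hinf.nonempty
  have hface (n : ℕ) (hn : n ∈ E ⁻¹' {E₀}) :
      ∃ x ∈ maxFace (φ i) (b n).coeff.support, ∃ y ∈ maxFace (φ i) (b n).coeff.support, x ≠ y := by
    have h : maxFace (φ i) (a 0).coeff.support = maxFace (φ n) (a 0).coeff.support :=
      congrArg Subtype.val ((show E i = E₀ from hi).trans (show E n = E₀ from hn).symm)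
    exact Finset.one_lt_card.1
      ((hφ n).trans_le (Finset.card_le_card (maxFace_subset_of_dvd (ha0 0) (hbdvd n) h)))
  -- A one-point face of `a 0` would force a one-point face on its divisor `b i`.
  obtain ⟨p, hp, q, hq, hpq⟩ : ∃ p ∈ maxFace (φ i) (a 0).coeff.support,
      ∃ q ∈ maxFace (φ i) (a 0).coeff.support, p ≠ q := by
    by_contra! hcon
    obtain ⟨x, hx, y, hy, hxy⟩ := hface i hi
    obtain ⟨χ, hχ⟩ := exists_addMonoidHom_rat_ne hxy
    exact hχ (eq_of_mem_maxFace_of_dvd (ha0 0) (hbdvd i)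
      (fun x hx y hy ↦ by rw [hcon x hx y hy]) hx hy)
  obtain ⟨c₀, hc₀, hc⟩ := hG (p - q) (sub_ne_zero.2 hpq)
  obtain ⟨χ, hχ⟩ := exists_addMonoidHom_rat_ne hc₀
  rw [map_zero] at hχ
  have hδ : 0 < |χ c₀| := abs_pos.2 hχ
  have hwidth (n : ℕ) (hn : n ∈ E ⁻¹' {E₀}) : |χ c₀| ≤ faceWidth (φ i) χ (b n) := by
    obtain ⟨x, hx, y, hy, hxy⟩ := hface n hn
    obtain ⟨k, l, hk, hkl⟩ := exists_zsmul_eq_zsmul_of_forall_addMonoidHom_rat (c := p - q)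
      (x := x - y) fun η hη ↦ by
        rw [map_sub, sub_eq_zero] at hη ⊢
        refine eq_of_mem_maxFace_of_dvd (ha0 0) (hbdvd n) (fun r hr s hs ↦ ?_) hx hy
        rw [hφ' i p hp q hq r hr hpq η hη, hφ' i p hp q hq s hs hpq η hη]
    obtain ⟨t, ht⟩ := AddSubgroup.mem_zmultiples_iff.1 (hc _ k l hk hkl)
    have ht0 : t ≠ 0 := by
      rintro rfl
      exact hxy (sub_eq_zero.1 (by rw [← ht, zero_smul]))
    have h1 : |χ c₀| ≤ |χ x - χ y| := by
      rw [← map_sub, ← ht, map_zsmul, zsmul_eq_mul, abs_mul]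
      exact le_mul_of_one_le_left hδ.le (by exact_mod_cast Int.one_le_abs ht0)
    refine h1.trans (abs_le'.2 ⟨sub_le_faceWidth hx hy, ?_⟩)
    rw [neg_sub]
    exact sub_le_faceWidth hy hx
  have hW (n : ℕ) : faceWidth (φ i) χ (a n) =
      faceWidth (φ i) χ (a (n + 1)) + faceWidth (φ i) χ (b n) := by
    conv_lhs => rw [hb n]
    exact faceWidth_mul _ _ (ha0 _) (hb0 _)
  have hanti : Antitone fun n ↦ faceWidth (φ i) χ (a n) :=
    antitone_nat_of_succ_le fun n ↦ by
      have := faceWidth_nonneg (φ i) χ (hb0 n)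
      simp only [hW n]
      linarith
  have hdec (k : ℕ) : ∃ n, faceWidth (φ i) χ (a n) ≤ faceWidth (φ i) χ (a 0) - k * |χ c₀| := by
    induction k with
    | zero => exact ⟨0, by simp⟩
    | succ k ih =>
      obtain ⟨n, hn⟩ := ih
      obtain ⟨m, hm, hnm⟩ := hinf.exists_gt n
      refine ⟨m + 1, ?_⟩
      have h1 := hwidth m hm
      have h2 := hW m
      have h3 := hanti hnm.le
      push_cast
      simp only at h3
      linarith
  obtain ⟨k, hk⟩ := exists_nat_gt (faceWidth (φ i) χ (a 0) / |χ c₀|)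
  rw [div_lt_iff₀ hδ] at hk
  obtain ⟨n, hn⟩ := hdec k
  linarith [faceWidth_nonneg (φ i) χ (ha0 n)]

end AddMonoidAlgebra

/-- Take `c₀` generating a maximal cyclic subgroup containing `c`. If `x` is rationally dependent on
`c`, then `x` and `c₀` lie in a common cyclic subgroup, which maximality identifies with that of
`c₀`. -/
theorem ACCOnCyclicSubgroups.exists_pure {G : Type*} [AddCommGroup G] [IsAddTorsionFree G]
    (h : ACCOnCyclicSubgroups G) (c : G) (hc : c ≠ 0) :
    ∃ c₀ : G, c₀ ≠ 0 ∧ ∀ x : G, ∀ n m : ℤ, n ≠ 0 → n • x = m • c →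
      x ∈ AddSubgroup.zmultiples c₀ := by
  let T := {H : AddSubgroup G // IsAddCyclic H}
  have hwf : WellFoundedGT T := by
    rw [wellFoundedGT_iff_monotone_chain_condition]
    intro a
    obtain ⟨n, hn⟩ := h (fun n ↦ (a n).1) (fun i j hij ↦ a.monotone hij) fun n ↦ (a n).2
    exact ⟨n, fun m hm ↦ Subtype.ext (hn m hm).symm⟩
  obtain ⟨⟨H, hH⟩, hcH, hmax⟩ := hwf.wf.has_min {H : T | c ∈ H.1}
    ⟨⟨AddSubgroup.zmultiples c, inferInstance⟩, AddSubgroup.mem_zmultiples c⟩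
  obtain ⟨c₀, rfl⟩ := (AddSubgroup.isAddCyclic_iff_exists_zmultiples_eq_top H).1 hH
  obtain ⟨k, hk⟩ := AddSubgroup.mem_zmultiples_iff.1 (show c ∈ AddSubgroup.zmultiples c₀ from hcH)
  refine ⟨c₀, fun h0 ↦ hc (by rw [← hk, h0, smul_zero]), fun x n m hn hx ↦ ?_⟩
  rw [← hk, smul_smul] at hx
  obtain ⟨n', m', hnm, hn', hm'⟩ := Int.exists_gcd_one (m := n) (n := m * k)
    (Int.gcd_pos_of_ne_zero_left _ hn)
  have hd : (Int.gcd n (m * k) : ℤ) ≠ 0 := by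
    exact_mod_cast (Int.gcd_pos_of_ne_zero_left _ hn).ne'
  have hx' : n' • x = m' • c₀ := by
    refine smul_right_injective G hd ?_
    simp only [smul_smul]
    rw [mul_comm _ n', mul_comm _ m', ← hn', ← hm', hx]
  -- By Bézout `v • x + u • c₀` is the common generator: `n'` times it is `c₀` and `m'` times it is
  -- `x`.
  obtain ⟨u, v, huv⟩ := Int.isCoprime_iff_gcd_eq_one.2 hnm
  have hy : n' • (v • x + u • c₀) = c₀ := by
    rw [smul_add, smul_comm, hx', smul_smul, smul_smul, ← add_smul, mul_comm n' u, add_comm, huv,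
      one_smul]
  have hxy : m' • (v • x + u • c₀) = x := by
    rw [smul_add, smul_comm m' u, ← hx', smul_smul, smul_smul, ← add_smul, mul_comm m' v, add_comm,
      huv, one_smul]
  have hle : AddSubgroup.zmultiples c₀ ≤ AddSubgroup.zmultiples (v • x + u • c₀) :=
    AddSubgroup.zmultiples_le_of_mem ⟨n', hy⟩
  have hge : AddSubgroup.zmultiples (v • x + u • c₀) ≤ AddSubgroup.zmultiples c₀ := by
    by_contra hcon
    exact hmax ⟨AddSubgroup.zmultiples (v • x + u • c₀), inferInstance⟩ (hle hcH)
      (lt_of_le_not_ge hle hcon)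
  exact hge ⟨m', hxy⟩

/-! ### Factoriality of the group algebra. -/

namespace AddMonoidAlgebra

theorem uniqueFactorizationMonoid_int {R : Type*} [CommRing R] [IsDomain R]
    [UniqueFactorizationMonoid R] : UniqueFactorizationMonoid R[ℤ] :=
  UniqueFactorizationMonoid.of_isLocalization
    (Submonoid.powers (Polynomial.X : Polynomial R)) (LaurentPolynomial R)

theorem uniqueFactorizationMonoid_fin {K : Type*} [Field K] (n : ℕ) :
    UniqueFactorizationMonoid K[Fin n → ℤ] := by
  induction n with
  | zero =>
    exact (uniqueRingEquiv (R := K) (M := Fin 0 → ℤ)).symm.toMulEquiv.uniqueFactorizationMonoid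
      inferInstance
  | succ n ih =>
    have : UniqueSums (Fin n → ℤ) := uniqueSums_of_isAddTorsionFree _
    have := uniqueFactorizationMonoid_int (R := K[Fin n → ℤ])
    let e : ℤ × (Fin n → ℤ) ≃+ (Fin (n + 1) → ℤ) :=
      { Fin.consEquiv (fun _ ↦ ℤ) with
        map_add' := fun a b ↦ by
          ext i
          refine Fin.cases ?_ (fun j ↦ ?_) i <;> simp [Fin.consEquiv] }
    exact ((curryRingEquiv (R := K) (M := ℤ) (N := Fin n → ℤ)).symm.trans
      (domCongr K K e).toRingEquiv).toMulEquiv.uniqueFactorizationMonoid this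

theorem uniqueFactorizationMonoid_of_fg {K H : Type*} [Field K] [AddCommGroup H]
    [IsAddTorsionFree H] [AddGroup.FG H] : UniqueFactorizationMonoid K[H] := by
  have : Module.Finite ℤ H := Module.Finite.iff_addGroup_fg.2 inferInstance
  have e := (Module.finBasis ℤ H).equivFun.toAddEquiv
  exact (domCongr K K e.symm).toRingEquiv.toMulEquiv.uniqueFactorizationMonoid
    (uniqueFactorizationMonoid_fin _)

theorem exists_fg_subset_range {K G : Type*} [Field K] [AddCommGroup G] (A : Finset K[G]) :
    ∃ H : AddSubgroup G, H.FG ∧ ∀ f ∈ A, ∃ f', mapDomainRingHom K H.subtype f' = f := by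
  classical
  refine ⟨AddSubgroup.closure (A.biUnion fun f ↦ f.coeff.support : Finset G), ⟨_, rfl⟩,
    fun f hf ↦ ⟨comapDomain _ (AddSubgroup.subtype_injective _) f, mapDomain_comapDomain ?_ _⟩⟩
  intro g hg
  exact ⟨⟨g, AddSubgroup.subset_closure (by
    rw [Finset.mem_coe, Finset.mem_biUnion]; exact ⟨f, hf, hg⟩)⟩, rfl⟩

variable {K G : Type*} [Field K] [AddCommGroup G] [IsAddTorsionFree G]

/-- A unit divides `1`, whose support is a point; with `φ = 0` the face is the whole support, so all
widths of the unit vanish. -/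
theorem isUnit_iff_card_support {f : K[G]} : IsUnit f ↔ f.coeff.support.card = 1 := by
  have : UniqueSums G := uniqueSums_of_isAddTorsionFree G
  constructor
  · intro hf
    have hf0 : f ≠ 0 := hf.ne_zero
    refine le_antisymm (Finset.card_le_one.2 fun x hx y hy ↦ ?_)
      (Finset.card_pos.2 (Finsupp.support_nonempty_iff.2 (by simpa using hf0)))
    by_contra hxy
    obtain ⟨χ, hχ⟩ := exists_addMonoidHom_rat_ne hxy
    have h1 {z : G} (hz : z ∈ maxFace 0 (1 : K[G]).coeff.support) : z = 0 := by
      have := (mem_maxFace.1 hz).1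
      rw [one_def, coeff_single] at this
      simpa using Finsupp.support_single_subset this
    refine hχ (eq_of_mem_maxFace_of_dvd (φ := 0) one_ne_zero hf.dvd
      (fun a ha b hb ↦ by rw [h1 ha, h1 hb]) ?_ ?_)
    exacts [mem_maxFace.2 ⟨hx, fun _ _ ↦ le_rfl⟩, mem_maxFace.2 ⟨hy, fun _ _ ↦ le_rfl⟩]
  · intro h
    by_contra hf
    have hf0 : f ≠ 0 := by rintro rfl; simp at h
    exact absurd (one_lt_card_support hf0 hf) (by omega)

theorem isUnit_mapDomainRingHom_subtype_iff {H : AddSubgroup G} {f : K[H]} :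
    IsUnit (mapDomainRingHom K H.subtype f) ↔ IsUnit f := by
  classical
  rw [isUnit_iff_card_support, isUnit_iff_card_support, mapDomainRingHom_apply, coeff_mapDomain,
    Finsupp.mapDomain_support_of_injective H.subtype_injective,
    Finset.card_image_of_injective _ H.subtype_injective]

/-- A relation `a * b = p * c` involves finitely many exponents, so it lives in a factorial `K[H]`
with `H` finitely generated. Irreducibility of `p` descends to `K[H]` because being a unit depends
only on the size of the support. -/
theorem prime_of_irreducible {p : K[G]} (hp : Irreducible p) : Prime p := by
  classical
  refine ⟨hp.ne_zero, hp.not_isUnit, fun a b ⟨c, hc⟩ ↦ ?_⟩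
  obtain ⟨H, hH, hA⟩ := exists_fg_subset_range {p, a, b, c}
  obtain ⟨p, rfl⟩ := hA p (by simp)
  obtain ⟨a, rfl⟩ := hA a (by simp)
  obtain ⟨b, rfl⟩ := hA b (by simp)
  obtain ⟨c, rfl⟩ := hA c (by simp)
  have hinj : Function.Injective (mapDomainRingHom K H.subtype) :=
    mapDomain_injective H.subtype_injective
  have : AddGroup.FG H := (AddGroup.fg_iff_addSubgroup_fg H).2 hH
  have : IsAddTorsionFree H := H.subtype_injective.isAddTorsionFree
  have : UniqueFactorizationMonoid K[H] := uniqueFactorizationMonoid_of_fg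
  have hp' : Irreducible p := by
    refine ⟨fun h ↦ hp.not_isUnit (isUnit_mapDomainRingHom_subtype_iff.2 h), fun x y hxy ↦ ?_⟩
    have := hp.isUnit_or_isUnit (a := mapDomainRingHom K H.subtype x)
      (b := mapDomainRingHom K H.subtype y) (by rw [hxy, map_mul])
    rwa [isUnit_mapDomainRingHom_subtype_iff, isUnit_mapDomainRingHom_subtype_iff] at this
  rw [← map_mul, ← map_mul] at hc
  exact ((UniqueFactorizationMonoid.irreducible_iff_prime.1 hp').dvd_or_dvd ⟨c, hinj hc⟩).imp
    (map_dvd _) (map_dvd _)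

theorem uniqueFactorizationMonoid_of_acc (h : ACCOnCyclicSubgroups G) :
    UniqueFactorizationMonoid K[G] :=
  have : UniqueSums G := uniqueSums_of_isAddTorsionFree G
  have := wfDvdMonoid (K := K) h.exists_pure
  { irreducible_iff_prime := ⟨prime_of_irreducible, Prime.irreducible⟩ }

end AddMonoidAlgebra

/-! ### Krull domains from valuations on the ring; valuations of primes. -/

/-- A family of integral valuations on a domain that is of finite character and detects
divisibility. -/
structure IsKrullFamily {ι R : Type*} [CommRing R] (v : ι → Valuation R ℤᵐ⁰) : Prop where
  ne_zero : ∀ i x, x ≠ 0 → v i x ≠ 0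
  le_one : ∀ i x, v i x ≤ 1
  dvd : ∀ a b, b ≠ 0 → (∀ i, v i a ≤ v i b) → b ∣ a
  finite : ∀ x, x ≠ 0 → {i | v i x ≠ 1}.Finite

/-- The members extend to the fraction field. Those with trivial extension can be dropped, since a
value greater than `1` already shows nontriviality. -/
theorem IsKrullFamily.isKrullDomain {ι R : Type*} [CommRing R] [IsDomain R]
    {v : ι → Valuation R ℤᵐ⁰} (hv : IsKrullFamily v) : IsKrullDomain R := by
  have hS (i : ι) : nonZeroDivisors R ≤ (v i).supp.primeCompl := fun x hx hx' ↦
    hv.ne_zero i x (nonZeroDivisors.ne_zero hx) ((v i).mem_supp_iff x |>.1 hx')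
  let w (i : ι) : Valuation (FractionRing R) ℤᵐ⁰ :=
    (v i).extendToLocalization (hS i) (FractionRing R)
  have hw (i : ι) (a : R) : w i (algebraMap R _ a) = v i a :=
    (v i).extendToLocalization_apply_map_apply (hS i) (FractionRing R) a
  have hwdiv (i : ι) (a b : R) :
      w i (algebraMap R _ a / algebraMap R _ b) = v i a / v i b := by
    rw [map_div₀, hw, hw]
  refine ⟨inferInstance, {u | u.IsNontrivial ∧ ∃ i, w i = u}, fun u hu ↦ hu.1, fun x ↦ ?_,
    fun x hx ↦ ?_⟩
  · constructor
    · rintro ⟨a, rfl⟩ u ⟨-, i, rfl⟩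
      rw [hw]
      exact hv.le_one i a
    · intro h
      obtain ⟨a, b, hb, rfl⟩ := IsFractionRing.div_surjective (A := R) x
      have hb0 := nonZeroDivisors.ne_zero hb
      obtain ⟨c, rfl⟩ := hv.dvd a b hb0 fun i ↦ by
        have h1 : w i (algebraMap R _ a / algebraMap R _ b) ≤ 1 := by
          by_cases hi : (w i).IsNontrivial
          · exact h _ ⟨hi, i, rfl⟩
          · by_contra hcon
            exact hi ⟨⟨_, fun h0 ↦ hcon (by rw [h0]; exact zero_le_one), fun h1 ↦ hcon h1.le⟩⟩
        rwa [hwdiv, div_le_one₀ (zero_lt_iff.2 (hv.ne_zero i b hb0))] at h1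
      refine ⟨c, ?_⟩
      rw [map_mul, mul_div_cancel_left₀]
      exact (map_ne_zero_iff _ (IsFractionRing.injective R _)).2 hb0
  · obtain ⟨a, b, hb, rfl⟩ := IsFractionRing.div_surjective (A := R) x
    have hb0 := nonZeroDivisors.ne_zero hb
    have ha0 : a ≠ 0 := by rintro rfl; simp at hx
    refine (((hv.finite a ha0).union (hv.finite b hb0)).image w).subset ?_
    rintro u ⟨⟨-, i, rfl⟩, hu⟩
    refine ⟨i, ?_, rfl⟩
    by_contra hcon
    simp only [Set.mem_union, Set.mem_ofPred_eq, not_or, not_not] at hcon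
    rw [hwdiv, hcon.1, hcon.2, div_one] at hu
    exact hu rfl

section PrimeValuation

variable {R : Type*} [CommRing R]

open Classical in
/-- The function underlying the valuation attached to a prime element. -/
noncomputable def primeValuationFun (p x : R) : ℤᵐ⁰ :=
  if x = 0 then 0 else WithZero.exp (-(multiplicity p x : ℤ))

theorem primeValuationFun_of_ne_zero (p : R) {x : R} (hx : x ≠ 0) :
    primeValuationFun p x = WithZero.exp (-(multiplicity p x : ℤ)) := if_neg hx

variable [IsDomain R] [WfDvdMonoid R]

theorem primeValuationFun_le_iff {p : R} (hp : Prime p) {x : R} {n : ℕ} :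
    primeValuationFun p x ≤ WithZero.exp (-(n : ℤ)) ↔ p ^ n ∣ x := by
  rcases eq_or_ne x 0 with rfl | hx
  · simp [primeValuationFun]
  · rw [primeValuationFun_of_ne_zero p hx, WithZero.exp_le_exp, neg_le_neg_iff, Nat.cast_le,
      (FiniteMultiplicity.of_not_isUnit hp.not_isUnit hx).pow_dvd_iff_le_multiplicity]

/-- The valuation attached to a prime element. -/
noncomputable def primeValuation (p : R) (hp : Prime p) : Valuation R ℤᵐ⁰ where
  toFun := primeValuationFun p
  map_zero' := if_pos rfl
  map_one' := by
    rw [primeValuationFun_of_ne_zero p one_ne_zero, multiplicity_eq_zero.2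
      (fun h ↦ hp.not_isUnit (isUnit_of_dvd_one h))]
    simp
  map_mul' x y := by
    rcases eq_or_ne x 0 with rfl | hx
    · simp [primeValuationFun]
    rcases eq_or_ne y 0 with rfl | hy
    · simp [primeValuationFun]
    have hxy := mul_ne_zero hx hy
    rw [primeValuationFun_of_ne_zero p hx, primeValuationFun_of_ne_zero p hy,
      primeValuationFun_of_ne_zero p hxy,
      multiplicity_mul hp (FiniteMultiplicity.of_not_isUnit hp.not_isUnit hxy), ← WithZero.exp_add,
      Nat.cast_add, neg_add]
  map_add_le_max' x y := by
    rcases eq_or_ne x 0 with rfl | hx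
    · simp
    rcases eq_or_ne y 0 with rfl | hy
    · simp
    have key (z : R) (hz : z ≠ 0) (h : primeValuationFun p x ≤ primeValuationFun p z)
        (h' : primeValuationFun p y ≤ primeValuationFun p z) :
        primeValuationFun p (x + y) ≤ primeValuationFun p z := by
      rw [primeValuationFun_of_ne_zero p hz, primeValuationFun_le_iff hp] at *
      exact dvd_add h h'
    rcases le_total (primeValuationFun p x) (primeValuationFun p y) with h | h
    · exact (key y hy h le_rfl).trans (le_max_right _ _)
    · exact (key x hx le_rfl h).trans (le_max_left _ _)

theorem primeValuation_le_iff {p : R} (hp : Prime p) {x : R} {n : ℕ} :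
    primeValuation p hp x ≤ WithZero.exp (-(n : ℤ)) ↔ p ^ n ∣ x :=
  primeValuationFun_le_iff hp

theorem primeValuation_of_ne_zero {p : R} (hp : Prime p) {x : R} (hx : x ≠ 0) :
    primeValuation p hp x = WithZero.exp (-(multiplicity p x : ℤ)) := if_neg hx

end PrimeValuation

open UniqueFactorizationMonoid in
-- Normalized primes give one index per associate class, so finite character is the finiteness of
-- the set of normalized factors.
theorem isKrullFamily_primeValuation {R : Type*} [CommRing R] [IsDomain R]
    [UniqueFactorizationMonoid R] [NormalizationMonoid R] :
    IsKrullFamily fun p : {p : R // Prime p ∧ normalize p = p} ↦ primeValuation p.1 p.2.1 where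
  ne_zero p x hx := by
    rw [primeValuation_of_ne_zero _ hx]
    exact WithZero.exp_ne_zero
  le_one p x := by
    have := (primeValuation_le_iff p.2.1 (x := x) (n := 0)).2 (by simp)
    simpa using this
  dvd a b hb h := by
    rcases eq_or_ne a 0 with rfl | ha
    · exact dvd_zero b
    classical
    rw [dvd_iff_normalizedFactors_le_normalizedFactors hb ha, Multiset.le_iff_count]
    intro p
    by_cases hp : p ∈ normalizedFactors b
    · have hprime := prime_of_normalized_factor p hp
      have hn := normalize_normalized_factor p hp
      have h1 := h ⟨p, hprime, hn⟩
      simp only at h1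
      rw [primeValuation_of_ne_zero _ hb, primeValuation_le_iff] at h1
      have h2 := pow_dvd_iff_le_emultiplicity.1 h1
      rw [emultiplicity_eq_count_normalizedFactors hprime.irreducible ha, hn, Nat.cast_le] at h2
      refine le_trans (le_of_eq ?_) h2
      refine (multiplicity_eq_of_emultiplicity_eq_some ?_).symm
      rw [emultiplicity_eq_count_normalizedFactors hprime.irreducible hb, hn]
    · rw [Multiset.count_eq_zero_of_notMem hp]
      exact Nat.zero_le _
  finite x hx := by
    classical
    refine Set.Finite.subset ((normalizedFactors x).toFinset.finite_toSet.preimage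
      Subtype.val_injective.injOn) fun p hp ↦ ?_
    rw [Set.mem_preimage, Finset.mem_coe, Multiset.mem_toFinset, mem_normalizedFactors_iff' hx]
    refine ⟨p.2.1.irreducible, p.2.2, ?_⟩
    by_contra hcon
    refine hp ?_
    rw [primeValuation_of_ne_zero _ hx, multiplicity_eq_zero.2 hcon]
    simp

theorem exists_isKrullFamily.{u} {R : Type u} [CommRing R] [IsDomain R]
    [UniqueFactorizationMonoid R] :
    ∃ (ι : Type u) (v : ι → Valuation R ℤᵐ⁰), IsKrullFamily v :=
  have : StrongNormalizationMonoid R := UniqueFactorizationMonoid.strongNormalizationMonoid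
  ⟨_, _, isKrullFamily_primeValuation⟩

/-! ### Sufficiency: `D[S]` inside the group algebra over the quotient field. -/

namespace Algebra.GrothendieckAddGroup

variable {S : Type*} [AddCommMonoid S]

theorem exists_eq_of_sub_of (g : GrothendieckAddGroup S) :
    ∃ s t : S, g = of s - of t := by
  obtain ⟨⟨s, t⟩, h⟩ := (AddLocalization.addMonoidOf (⊤ : AddSubmonoid S)).surj g
  exact ⟨s, t, eq_sub_of_add_eq h⟩

theorem isAddTorsionFree [IsCancelAdd S] [IsAddTorsionFree S] :
    IsAddTorsionFree (GrothendieckAddGroup S) := by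
  refine ⟨fun n hn x y hxy ↦ ?_⟩
  obtain ⟨a, b, rfl⟩ := exists_eq_of_sub_of x
  obtain ⟨c, d, rfl⟩ := exists_eq_of_sub_of y
  simp only [smul_sub, ← map_nsmul, sub_eq_sub_iff_add_eq_add, ← map_add, ← nsmul_add] at hxy
  rw [sub_eq_sub_iff_add_eq_add, ← map_add, ← map_add]
  exact congrArg _ (nsmul_right_injective hn (of_injective hxy))

end Algebra.GrothendieckAddGroup

namespace AddMonoidAlgebra

open Algebra (GrothendieckAddGroup)

variable {D S : Type*} [CommRing D] [AddCommMonoid S]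

variable (D S) in
/-- The map from a monoid algebra to the group algebra of the quotient group over the quotient
field. -/
noncomputable def toFractionGroupAlgebra :
    D[S] →+* (FractionRing D)[GrothendieckAddGroup S] :=
  (mapDomainRingHom _ GrothendieckAddGroup.of).comp (mapRingHom S (algebraMap D (FractionRing D)))

theorem toFractionGroupAlgebra_apply (f : D[S]) : toFractionGroupAlgebra D S f =
    mapDomain GrothendieckAddGroup.of (map (algebraMap D (FractionRing D) : D →+ _) f) := rfl

variable [IsCancelAdd S]

theorem toFractionGroupAlgebra_injective : Function.Injective (toFractionGroupAlgebra D S) :=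
  (mapDomain_injective GrothendieckAddGroup.of_injective).comp
    (map_injective _ (IsFractionRing.injective D (FractionRing D)))

theorem mem_range_toFractionGroupAlgebra {q : (FractionRing D)[GrothendieckAddGroup S]} :
    q ∈ Set.range (toFractionGroupAlgebra D S) ↔
      (∀ g, q.coeff g ∈ Set.range (algebraMap D (FractionRing D))) ∧
      ∀ g ∈ q.coeff.support, g ∈ Set.range (GrothendieckAddGroup.of (M := S)) := by
  classical
  constructor
  · rintro ⟨f, rfl⟩
    have hsupp : ∀ g ∈ (toFractionGroupAlgebra D S f).coeff.support,
        g ∈ Set.range (GrothendieckAddGroup.of (M := S)) := fun g hg ↦ by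
      obtain ⟨s, -, hs⟩ := Finset.mem_image.1 (Finsupp.mapDomain_support hg)
      exact ⟨s, hs⟩
    refine ⟨fun g ↦ ?_, hsupp⟩
    by_cases hg : g ∈ (toFractionGroupAlgebra D S f).coeff.support
    · obtain ⟨s, rfl⟩ := hsupp g hg
      rw [toFractionGroupAlgebra_apply, coeff_mapDomain,
        Finsupp.mapDomain_apply GrothendieckAddGroup.of_injective, coeff_map]
      exact ⟨f.coeff s, rfl⟩
    · rw [Finsupp.notMem_support_iff.1 hg]
      exact ⟨0, map_zero _⟩
  · rintro ⟨h1, h2⟩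
    have h3 : comapDomain GrothendieckAddGroup.of GrothendieckAddGroup.of_injective q ∈
        Set.range (map (M := S) (algebraMap D (FractionRing D) : D →+ _)) := by
      rw [range_map]
      exact fun s ↦ h1 _
    obtain ⟨f, hf⟩ := h3
    refine ⟨f, ?_⟩
    rw [toFractionGroupAlgebra_apply, hf]
    exact mapDomain_comapDomain (fun g hg ↦ h2 g hg) _

section Families

variable {K G : Type*} [Field K] [AddCommGroup G] [UniqueSums G]

theorem gaussValuation_one_le_one_iff (v : Valuation K ℤᵐ⁰) {f : K[G]} :
    gaussValuation v 1 f ≤ 1 ↔ ∀ g, v (f.coeff g) ≤ 1 := by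
  simp [gaussValuation_le_iff]

/-- The Gauss value is the value of some coefficient, so it differs from `1` only if one of the
finitely many nonzero coefficients has value different from `1`. -/
theorem finite_gaussValuation_one {V : Set (Valuation K ℤᵐ⁰)}
    (hV : ∀ x, x ≠ 0 → {v ∈ V | v x ≠ 1}.Finite) {f : K[G]} (hf : f ≠ 0) :
    {v ∈ V | gaussValuation v 1 f ≠ 1}.Finite := by
  refine (Set.Finite.biUnion f.coeff.support.finite_toSet
    fun g hg ↦ hV (f.coeff g) (Finsupp.mem_support_iff.1 hg)).subset ?_
  rintro v ⟨hv, hvf⟩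
  obtain ⟨g, hg, h⟩ := exists_gaussValuation_eq v 1 hf
  refine Set.mem_biUnion hg ⟨hv, fun h1 ↦ hvf ?_⟩
  rw [h, h1]
  simp

open Classical in
/-- The valuation on a group algebra given by the minimal value of `w` on the support. -/
noncomputable def monomialValuation (w : G →+ ℤ) : Valuation K[G] ℤᵐ⁰ :=
  gaussValuation (1 : Valuation K ℤᵐ⁰) (expHom (-w))

theorem monomialValuation_le_one_iff (w : G →+ ℤ) {f : K[G]} :
    monomialValuation w f ≤ 1 ↔ ∀ g ∈ f.coeff.support, 0 ≤ w g := by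
  classical
  rw [monomialValuation, gaussValuation_le_iff]
  refine forall_congr' fun g ↦ ?_
  by_cases hg : f.coeff g = 0
  · simp [hg]
  · rw [Valuation.one_apply_of_ne_zero hg, one_mul, expHom_apply, ← WithZero.exp_zero,
      WithZero.exp_le_exp]
    simp [hg]

theorem monomialValuation_ne_zero (w : G →+ ℤ) {f : K[G]} (hf : f ≠ 0) :
    monomialValuation w f ≠ 0 := by
  classical
  exact gaussValuation_ne_zero _ _ hf

theorem finite_monomialValuation {W : Set (G →+ ℤ)} (hW : ∀ g, {w ∈ W | w g ≠ 0}.Finite)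
    {f : K[G]} (hf : f ≠ 0) : {w ∈ W | monomialValuation w f ≠ 1}.Finite := by
  classical
  refine (Set.Finite.biUnion f.coeff.support.finite_toSet fun g _ ↦ hW g).subset ?_
  rintro w ⟨hw, hwf⟩
  obtain ⟨g, hg, h⟩ := exists_gaussValuation_eq (1 : Valuation K ℤᵐ⁰) (expHom (-w)) hf
  refine Set.mem_biUnion hg ⟨hw, fun h1 ↦ hwf ?_⟩
  rw [monomialValuation, h, Valuation.one_apply_of_ne_zero (Finsupp.mem_support_iff.1 hg), one_mul,
    expHom_apply, AddMonoidHom.neg_apply, h1, neg_zero, WithZero.exp_zero]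

end Families

variable [IsDomain D]

theorem isDomain_of_isAddTorsionFree [IsAddTorsionFree S] : IsDomain D[S] := by
  have := GrothendieckAddGroup.isAddTorsionFree (S := S)
  have := uniqueSums_of_isAddTorsionFree (GrothendieckAddGroup S)
  exact toFractionGroupAlgebra_injective.isDomain (toFractionGroupAlgebra D S)

theorem isKrullDomain [IsAddTorsionFree S] (hD : IsKrullDomain D) (hS : IsKrullAddMonoid S)
    (hG : ACCOnCyclicSubgroups (GrothendieckAddGroup S)) : IsKrullDomain D[S] := by
  have := GrothendieckAddGroup.isAddTorsionFree (S := S)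
  have := uniqueSums_of_isAddTorsionFree (GrothendieckAddGroup S)
  have := isDomain_of_isAddTorsionFree (D := D) (S := S)
  have := uniqueFactorizationMonoid_of_acc (K := FractionRing D) hG
  obtain ⟨-, V, -, hV, hVfin⟩ := hD
  obtain ⟨W, -, hW, hWfin⟩ := hS
  obtain ⟨ι, p, hp⟩ := exists_isKrullFamily (R := (FractionRing D)[GrothendieckAddGroup S])
  let j := toFractionGroupAlgebra D S
  have hj0 {x : D[S]} (hx : x ≠ 0) : j x ≠ 0 :=
    (map_ne_zero_iff _ toFractionGroupAlgebra_injective).2 hx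
  have hj (x : D[S]) := mem_range_toFractionGroupAlgebra.1 (Set.mem_range_self (f := j) x)
  refine IsKrullFamily.isKrullDomain (ι := V ⊕ W ⊕ ι) (v := Sum.elim
    (fun v ↦ (gaussValuation v.1 1).comap j)
    (Sum.elim (fun w ↦ (monomialValuation w.1).comap j) (fun i ↦ (p i).comap j)))
    ⟨?_, ?_, fun a b hb h ↦ ?_, fun x hx ↦ ?_⟩
  · rintro (v | w | i) x hx
    · exact gaussValuation_ne_zero _ _ (hj0 hx)
    · exact monomialValuation_ne_zero _ (hj0 hx)
    · exact hp.ne_zero _ _ (hj0 hx)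
  · rintro (v | w | i) x
    · exact (gaussValuation_one_le_one_iff _).2 fun g ↦ (hV _).1 ((hj x).1 g) _ v.2
    · exact (monomialValuation_le_one_iff _).2 fun g hg ↦ (hW _).1 ((hj x).2 g hg) _ w.2
    · exact hp.le_one _ _
  · obtain ⟨q, hq⟩ := hp.dvd (j a) (j b) (hj0 hb) fun i ↦ h (.inr (.inr i))
    have hle (u : Valuation (FractionRing D)[GrothendieckAddGroup S] ℤᵐ⁰) (hu : u (j b) ≠ 0)
        (hab : u (j a) ≤ u (j b)) : u q ≤ 1 := by
      rw [hq, map_mul] at hab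
      exact (mul_le_iff_le_one_right (zero_lt_iff.2 hu)).1 hab
    have hqr : q ∈ Set.range j := mem_range_toFractionGroupAlgebra.2
      ⟨fun g ↦ (hV _).2 fun v hv ↦ (gaussValuation_one_le_one_iff v).1
          (hle _ (gaussValuation_ne_zero _ _ (hj0 hb)) (h (.inl ⟨v, hv⟩))) g,
        fun g hg ↦ (hW _).2 fun w hw ↦ (monomialValuation_le_one_iff w).1
          (hle _ (monomialValuation_ne_zero _ (hj0 hb)) (h (.inr (.inl ⟨w, hw⟩)))) g hg⟩
    obtain ⟨c, rfl⟩ := hqr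
    exact ⟨c, toFractionGroupAlgebra_injective (hq.trans (map_mul j b c).symm)⟩
  · have h1 := (finite_gaussValuation_one hVfin (hj0 hx)).preimage
      (f := ((↑) : V → _)) Subtype.val_injective.injOn
    have h2 := (finite_monomialValuation hWfin (hj0 hx)).preimage
      (f := ((↑) : W → _)) Subtype.val_injective.injOn
    have h3 := hp.finite _ (hj0 hx)
    refine ((h1.image Sum.inl).union (((h2.image Sum.inl).union (h3.image Sum.inr)).image
      Sum.inr)).subset ?_
    rintro (v | w | i) h
    · exact .inl ⟨v, ⟨v.2, h⟩, rfl⟩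
    · exact .inr ⟨_, .inl ⟨w, ⟨w.2, h⟩, rfl⟩, rfl⟩
    · exact .inr ⟨_, .inr ⟨i, h, rfl⟩, rfl⟩

end AddMonoidAlgebra

/-! ### Stabilization of chains and of values. -/

theorem exists_forall_le_apply_nat (a : ℕ → ℕ) : ∃ N, ∀ n, a N ≤ a n := by
  obtain ⟨-, ⟨N, rfl⟩, hN⟩ := wellFounded_lt.has_min (Set.range a) ⟨_, 0, rfl⟩
  exact ⟨N, fun n ↦ not_lt.1 (hN _ ⟨n, rfl⟩)⟩

theorem exists_forall_ge_eq_of_antitone {a : ℕ → ℕ} (ha : Antitone a) :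
    ∃ N, ∀ n, N ≤ n → a n = a N := by
  obtain ⟨N, hN⟩ := exists_forall_le_apply_nat a
  exact ⟨N, fun n hn ↦ le_antisymm (ha hn) (hN n)⟩

/-- Choose generators and start the chain at a nonzero one; if there is none, the chain is
constantly zero. -/
theorem ACCOnCyclicSubgroups.of_sequences {G : Type*} [AddCommGroup G]
    (h : ∀ y : ℕ → G, y 0 ≠ 0 → (∀ n, y n ∈ AddSubgroup.zmultiples (y (n + 1))) →
      ∃ N, ∀ n, N ≤ n → y (n + 1) ∈ AddSubgroup.zmultiples (y n)) : ACCOnCyclicSubgroups G := by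
  intro H hH hcyc
  choose y hy using fun n ↦ (AddSubgroup.isAddCyclic_iff_exists_zmultiples_eq_top (H n)).1 (hcyc n)
  by_cases hbot : ∃ m, y m ≠ 0
  · obtain ⟨m, hm⟩ := hbot
    obtain ⟨N, hN⟩ := h (fun n ↦ y (m + n)) hm fun n ↦ by
      rw [hy]
      exact hH (Nat.le_succ _) (hy (m + n) ▸ AddSubgroup.mem_zmultiples _)
    refine ⟨m + N, fun n hn ↦ ?_⟩
    induction n, hn using Nat.le_induction with
    | base => rfl
    | succ n hn ih =>
      rw [← ih]
      refine le_antisymm ?_ (hH (Nat.le_succ n))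
      obtain ⟨k, rfl⟩ := Nat.exists_eq_add_of_le (show m ≤ n by omega)
      rw [← hy (m + k + 1), ← hy (m + k)]
      exact AddSubgroup.zmultiples_le_of_mem (hN k (by omega))
  · push Not at hbot
    exact ⟨0, fun n _ ↦ by rw [← hy n, ← hy 0, hbot, hbot]⟩

theorem Valuation.eventually_eq_succ_of_monotone {L : Type*} [Field L] (v : Valuation L ℤᵐ⁰)
    {x : ℕ → L} (hx : ∀ n, x n ≠ 0) (hx1 : ∀ n, v (x n) ≤ 1) (hmono : ∀ n, v (x n) ≤ v (x (n + 1))) :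
    ∀ᶠ n in Filter.atTop, v (x (n + 1)) = v (x n) := by
  have hx0 (n : ℕ) : v (x n) ≠ 0 := (v.ne_zero_iff).2 (hx n)
  have hlog (n : ℕ) : (v (x n)).log ≤ 0 := by
    rw [← WithZero.exp_le_exp, WithZero.exp_log (hx0 n)]
    exact hx1 n
  have hanti : Antitone fun n ↦ (v (x n)).log.natAbs := antitone_nat_of_succ_le fun n ↦ by
    have h1 : (v (x n)).log ≤ (v (x (n + 1))).log := by
      rw [← WithZero.exp_le_exp, WithZero.exp_log (hx0 n), WithZero.exp_log (hx0 _)]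
      exact hmono n
    have := hlog (n + 1)
    have := hlog n
    omega
  obtain ⟨N, hN⟩ := exists_forall_ge_eq_of_antitone hanti
  filter_upwards [Filter.eventually_ge_atTop N] with n hn
  have h1 := (hN n hn).trans (hN (n + 1) (by omega)).symm
  have h2 := hlog n
  have h3 := hlog (n + 1)
  rw [← WithZero.exp_log (hx0 n), ← WithZero.exp_log (hx0 (n + 1))]
  congr 1
  omega

/-! ### Necessity: restricting the valuations of `D[S]`. -/

namespace AddMonoidAlgebra

open Algebra (GrothendieckAddGroup)

variable {D S : Type*} [CommRing D] [AddCommMonoid S]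

theorem coeff_eq_mul_of_single_zero_eq [IsCancelAdd S] {a b : D} {f : D[S]}
    (h : (single 0 a : D[S]) = single 0 b * f) : a = b * f.coeff 0 := by
  have := congrArg (fun p : D[S] ↦ p.coeff 0) h
  simpa [coeff_single_zero_mul] using this

theorem exists_add_eq_of_single_eq [Nontrivial D] {s t : S} {f : D[S]}
    (h : (single s 1 : D[S]) = single t 1 * f) : ∃ u, t + u = s := by
  by_contra! hcon
  have := congrArg (fun p : D[S] ↦ p.coeff s) h
  rw [coeff_single_mul_of_forall_add_ne _ _ hcon] at this
  simp at this

variable [IsDomain D[S]]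

/-- Valuations restrict to the quotient field of `D`, the trivial restrictions being dropped. A
fraction of `D` lying in `D[S]` lies in `D`, by comparing coefficients at exponent `0`. -/
theorem isKrullDomain_base [IsCancelAdd S] [IsDomain D] (h : IsKrullDomain D[S]) :
    IsKrullDomain D := by
  obtain ⟨-, V, -, hV, hVfin⟩ := h
  let L := FractionRing D[S]
  have hinj : Function.Injective ((algebraMap D[S] L).comp (singleZeroRingHom (R := D) (M := S))) :=
    (IsFractionRing.injective D[S] L).comp (single_right_injective (m := (0 : S)))
  let i : FractionRing D →+* L := IsFractionRing.lift hinj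
  have hi (d : D) : i (algebraMap D _ d) = algebraMap D[S] L (single 0 d) :=
    IsFractionRing.lift_algebraMap hinj d
  refine ⟨inferInstance, {u | u.IsNontrivial ∧ ∃ v ∈ V, v.comap i = u}, fun u hu ↦ hu.1,
    fun x ↦ ⟨?_, fun h ↦ ?_⟩, fun x hx ↦ ?_⟩
  · rintro ⟨d, rfl⟩ u ⟨-, v, hv, rfl⟩
    rw [Valuation.comap_apply, hi]
    exact (hV _).1 ⟨_, rfl⟩ v hv
  · obtain ⟨f, hf⟩ := (hV (i x)).2 fun v hv ↦ by
      by_contra hcon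
      refine hcon (h (v.comap i) ⟨⟨x, fun h0 ↦ hcon ?_, fun h1 ↦ hcon ?_⟩, v, hv, rfl⟩)
      · exact (show v (i x) = 0 from h0) ▸ zero_le_one
      · exact (show v (i x) = 1 from h1).le
    obtain ⟨a, b, hb, rfl⟩ := IsFractionRing.div_surjective (A := D) x
    have hb0 : algebraMap D (FractionRing D) b ≠ 0 :=
      (map_ne_zero_iff _ (IsFractionRing.injective D _)).2 (nonZeroDivisors.ne_zero hb)
    rw [map_div₀, eq_div_iff ((map_ne_zero i).2 hb0), hi, hi, ← map_mul] at hf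
    have := coeff_eq_mul_of_single_zero_eq ((IsFractionRing.injective D[S] L hf).symm.trans
      (mul_comm _ _))
    exact ⟨f.coeff 0, by rw [this, map_mul, mul_div_cancel_left₀ _ hb0]⟩
  · refine ((hVfin (i x) ((map_ne_zero i).2 hx)).image fun v ↦ v.comap i).subset ?_
    rintro u ⟨⟨-, v, hv, rfl⟩, hu⟩
    exact ⟨v, ⟨hv, hu⟩, rfl⟩

omit [IsDomain D[S]] in
theorem algebraMap_single_one_ne_zero [Nontrivial D] (s : S) :
    algebraMap D[S] (FractionRing D[S]) (single s 1) ≠ 0 :=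
  (map_ne_zero_iff _ (IsFractionRing.injective D[S] _)).2 (single_ne_zero.2 one_ne_zero)

variable (D S) in
/-- The monomials with exponents in the quotient group, as units of the fraction field. -/
noncomputable def monomialUnit [Nontrivial D] :
    GrothendieckAddGroup S →+ Additive (FractionRing D[S])ˣ :=
  GrothendieckAddGroup.lift
    { toFun s := .ofMul (Units.mk0 _ (algebraMap_single_one_ne_zero (D := D) s))
      map_zero' := by
        apply Additive.toMul.injective
        ext
        simp [← one_def]
      map_add' s t := by
        apply Additive.toMul.injective
        ext
        simp [← map_mul, single_mul_single] }

variable (D) in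
/-- The monomial with exponent `g`, in the fraction field. -/
noncomputable def monomial [Nontrivial D] (g : GrothendieckAddGroup S) : FractionRing D[S] :=
  ((monomialUnit D S g).toMul : (FractionRing D[S])ˣ)

section Monomial

variable [Nontrivial D]

theorem monomial_of (s : S) : monomial D (GrothendieckAddGroup.of s) =
    algebraMap D[S] (FractionRing D[S]) (single s 1) := by
  rw [monomial, monomialUnit]
  simp [GrothendieckAddGroup.lift]

theorem monomial_add (g h : GrothendieckAddGroup S) :
    monomial D (g + h) = monomial D g * monomial D h := by
  rw [monomial, map_add, toMul_add, Units.val_mul]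
  rfl

theorem monomial_zero : monomial D (0 : GrothendieckAddGroup S) = 1 := by
  rw [monomial, map_zero, toMul_zero, Units.val_one]

theorem monomial_ne_zero (g : GrothendieckAddGroup S) : monomial D g ≠ 0 :=
  Units.ne_zero _

theorem monomial_mem_range_iff {g : GrothendieckAddGroup S} :
    monomial D g ∈ Set.range (algebraMap D[S] (FractionRing D[S])) ↔
      g ∈ Set.range (GrothendieckAddGroup.of (M := S)) := by
  constructor
  · rintro ⟨f, hf⟩
    obtain ⟨s, t, rfl⟩ := GrothendieckAddGroup.exists_eq_of_sub_of g
    have h : monomial D (GrothendieckAddGroup.of s) = monomial D (GrothendieckAddGroup.of t) *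
        algebraMap D[S] (FractionRing D[S]) f := by
      rw [hf, ← monomial_add, add_sub_cancel]
    rw [monomial_of, monomial_of, ← map_mul] at h
    obtain ⟨u, rfl⟩ := exists_add_eq_of_single_eq (IsFractionRing.injective D[S] _ h)
    exact ⟨u, by rw [map_add, add_sub_cancel_left]⟩
  · rintro ⟨s, rfl⟩
    exact ⟨_, (monomial_of s).symm⟩

/-- The homomorphism to `ℤ` given by the valuations of monomials. -/
noncomputable def monomialWeight (v : Valuation (FractionRing D[S]) ℤᵐ⁰) :
    GrothendieckAddGroup S →+ ℤ where
  toFun g := -(v (monomial D g)).log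
  map_zero' := by rw [monomial_zero, map_one, WithZero.log_one, neg_zero]
  map_add' g h := by
    rw [monomial_add, map_mul, WithZero.log_mul ((v.ne_zero_iff).2 (monomial_ne_zero g))
      ((v.ne_zero_iff).2 (monomial_ne_zero h)), neg_add]

theorem map_monomial (v : Valuation (FractionRing D[S]) ℤᵐ⁰) (g : GrothendieckAddGroup S) :
    v (monomial D g) = WithZero.exp (-monomialWeight v g) := by
  rw [monomialWeight]
  simp only [AddMonoidHom.coe_mk, ZeroHom.coe_mk, neg_neg]
  rw [WithZero.exp_log ((v.ne_zero_iff).2 (monomial_ne_zero g))]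

theorem map_monomial_le_one_iff {v : Valuation (FractionRing D[S]) ℤᵐ⁰}
    {g : GrothendieckAddGroup S} : v (monomial D g) ≤ 1 ↔ 0 ≤ monomialWeight v g := by
  rw [map_monomial, ← WithZero.exp_zero, WithZero.exp_le_exp, neg_nonpos]

theorem map_monomial_eq_one_iff {v : Valuation (FractionRing D[S]) ℤᵐ⁰}
    {g : GrothendieckAddGroup S} : v (monomial D g) = 1 ↔ monomialWeight v g = 0 := by
  rw [map_monomial, ← WithZero.exp_zero, WithZero.exp_inj, neg_eq_zero]

/-- A valuation restricted to monomials is an integer weight on `G`, and `X^g` lies in `D[S]`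
exactly when `g` lies in `S`. -/
theorem isKrullAddMonoid_exponents [IsCancelAdd S] (h : IsKrullDomain D[S]) :
    IsKrullAddMonoid S := by
  obtain ⟨-, V, -, hV, hVfin⟩ := h
  refine ⟨{w | w ≠ 0 ∧ ∃ v ∈ V, monomialWeight v = w}, fun w hw ↦ hw.1, fun g ↦ ?_, fun g ↦ ?_⟩
  · rw [← monomial_mem_range_iff (D := D), hV]
    simp only [map_monomial_le_one_iff]
    constructor
    · rintro h w ⟨-, v, hv, rfl⟩
      exact h v hv
    · intro h v hv
      by_cases hw : monomialWeight v = 0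
      · rw [hw, AddMonoidHom.zero_apply]
      · exact h _ ⟨hw, v, hv, rfl⟩
  · refine ((hVfin _ (monomial_ne_zero g)).image monomialWeight).subset ?_
    rintro w ⟨⟨-, v, hv, rfl⟩, hw⟩
    exact ⟨v, ⟨hv, fun h ↦ hw (map_monomial_eq_one_iff.1 h)⟩, rfl⟩

omit [IsDomain D[S]] in
-- Pass to exponents modulo the subgroup generated by `s`: there `1 - X^s` becomes zero, so `1 -
-- X^t` does too.
theorem of_mem_zmultiples_of_dvd {s t : S}
    (h : (1 - single s 1 : D[S]) ∣ 1 - single t 1) :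
    GrothendieckAddGroup.of t ∈ AddSubgroup.zmultiples (GrothendieckAddGroup.of s) := by
  let π := (QuotientAddGroup.mk' (AddSubgroup.zmultiples (GrothendieckAddGroup.of s))).comp
    (GrothendieckAddGroup.of (M := S))
  have h1 := map_dvd (mapDomainRingHom D π) h
  have hs : π s = 0 := (QuotientAddGroup.eq_zero_iff _).2 (AddSubgroup.mem_zmultiples _)
  rw [map_sub, map_sub, map_one, mapDomainRingHom_apply, mapDomainRingHom_apply, mapDomain_single,
    mapDomain_single, hs, ← one_def, sub_self, zero_dvd_iff, sub_eq_zero, one_def,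
    single_left_inj one_ne_zero] at h1
  exact (QuotientAddGroup.eq_zero_iff _).1 h1.symm

omit [Nontrivial D] [IsDomain D[S]] in
theorem one_sub_single_dvd [IsCancelAdd S] {s t : S} {k : ℤ}
    (h : k • GrothendieckAddGroup.of t = GrothendieckAddGroup.of s) :
    (1 - single t 1 : D[S]) ∣ 1 - single s 1 := by
  obtain ⟨n, rfl | rfl⟩ := k.eq_nat_or_neg
  · rw [natCast_zsmul, ← map_nsmul] at h
    have h1 : (single s 1 : D[S]) = single t 1 ^ n := by
      rw [single_pow, one_pow, GrothendieckAddGroup.of_injective h]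
    rw [h1]
    exact one_sub_dvd_one_sub_pow _ n
  · rw [neg_smul, natCast_zsmul, ← map_nsmul, neg_eq_iff_add_eq_zero, ← map_add,
      ← map_zero GrothendieckAddGroup.of] at h
    have h0 := GrothendieckAddGroup.of_injective h
    have h1 : (1 - single s 1 : D[S]) = -(single s 1) * (1 - single t 1 ^ n) := by
      rw [single_pow, one_pow, mul_sub, mul_one, neg_mul, single_mul_single, add_comm s, h0, one_mul,
        ← one_def]
      ring
    rw [h1]
    exact Dvd.dvd.mul_left (one_sub_dvd_one_sub_pow _ n) _

theorem accOnCyclicSubgroups [IsCancelAdd S] [IsAddTorsionFree S] (h : IsKrullDomain D[S]) :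
    ACCOnCyclicSubgroups (GrothendieckAddGroup S) := by
  have := GrothendieckAddGroup.isAddTorsionFree (S := S)
  obtain ⟨-, V, -, hV, hVfin⟩ := h
  refine ACCOnCyclicSubgroups.of_sequences fun y hy0 hy ↦ ?_
  choose k hk using fun n ↦ AddSubgroup.mem_zmultiples_iff.1 (hy n)
  have hyne (n : ℕ) : y n ≠ 0 := by
    induction n with
    | zero => exact hy0
    | succ n ih => exact fun h0 ↦ ih (by rw [← hk, h0, smul_zero])
  have hkne (n : ℕ) : k n ≠ 0 := fun h0 ↦ hyne n (by rw [← hk, h0, zero_smul])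
  have hw (v : Valuation (FractionRing D[S]) ℤᵐ⁰) (n : ℕ) :
      monomialWeight v (y n) = k n * monomialWeight v (y (n + 1)) := by
    conv_lhs => rw [← hk n, map_zsmul, smul_eq_mul]
  -- If some weight of `y 0` is nonzero, the factors `k n` successively divide it and are eventually
  -- `±1`. Otherwise all weights vanish on all `y n`, which then lie in `S`.
  by_cases hcase : ∃ v ∈ V, monomialWeight v (y 0) ≠ 0
  · obtain ⟨v, -, hv⟩ := hcase
    have hvne (n : ℕ) : monomialWeight v (y n) ≠ 0 := by
      induction n with
      | zero => exact hv
      | succ n ih => exact fun h0 ↦ ih (by rw [hw, h0, mul_zero])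
    have hanti : Antitone fun n ↦ (monomialWeight v (y n)).natAbs :=
      antitone_nat_of_succ_le fun n ↦ by
        simp only [hw v n, Int.natAbs_mul]
        exact Nat.le_mul_of_pos_left _ (Int.natAbs_pos.2 (hkne n))
    obtain ⟨N, hN⟩ := exists_forall_ge_eq_of_antitone hanti
    refine ⟨N, fun n hn ↦ ?_⟩
    have h1 := (hN n hn).trans (hN (n + 1) (by omega)).symm
    rw [hw v n, Int.natAbs_mul] at h1
    have h2 : (k n).natAbs = 1 :=
      Nat.eq_of_mul_eq_mul_right (Int.natAbs_pos.2 (hvne (n + 1))) (by rw [h1, one_mul])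
    refine AddSubgroup.mem_zmultiples_iff.2 ⟨k n, ?_⟩
    rw [← hk n, smul_smul, Int.isUnit_mul_self (Int.isUnit_iff_natAbs_eq.2 h2), one_smul]
  · push Not at hcase
    have hv0 (n : ℕ) : ∀ v ∈ V, monomialWeight v (y n) = 0 := by
      induction n with
      | zero => exact hcase
      | succ n ih =>
        exact fun v hv ↦ (mul_eq_zero.1 ((hw v n).symm.trans (ih v hv))).resolve_left (hkne n)
    have hmem (n : ℕ) : y n ∈ Set.range (GrothendieckAddGroup.of (M := S)) :=
      monomial_mem_range_iff.1 ((hV _).2 fun v hv ↦ map_monomial_le_one_iff.2 (hv0 n v hv).ge)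
    choose s hs using hmem
    let d (n : ℕ) : D[S] := 1 - single (s n) 1
    have hd0 (n : ℕ) : d n ≠ 0 := fun h0 ↦ hyne n (by
      rw [sub_eq_zero, one_def, single_left_inj one_ne_zero] at h0
      rw [← hs n, ← h0, map_zero])
    let x (n : ℕ) : FractionRing D[S] := algebraMap _ _ (d n)
    have hx0 (n : ℕ) : x n ≠ 0 := (map_ne_zero_iff _ (IsFractionRing.injective D[S] _)).2 (hd0 n)
    have hint (f : D[S]) : ∀ v ∈ V, v (algebraMap _ _ f) ≤ 1 := (hV _).1 ⟨f, rfl⟩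
    have hmono (n : ℕ) : ∀ v ∈ V, v (x n) ≤ v (x (n + 1)) := fun v hv ↦ by
      obtain ⟨u, hu⟩ := one_sub_single_dvd (D := D) (s := s n) (t := s (n + 1)) (k := k n)
        (by rw [hs, hs, hk])
      simp only [x, d]
      rw [hu, map_mul, map_mul]
      exact mul_le_of_le_one_right' (hint u v hv)
    have hfin := hVfin (x 0) (hx0 0)
    -- Values increase along the divisor chain and are at most `1`. Only the finitely many `v` with
    -- `v (x 0) ≠ 1` can change, and each is eventually constant; then successive terms divide each
    -- other.
    have hev : ∀ᶠ n in Filter.atTop, ∀ v ∈ {v ∈ V | v (x 0) ≠ 1}, v (x (n + 1)) = v (x n) := by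
      rw [Filter.eventually_all_finite hfin]
      exact fun v hv ↦ v.eventually_eq_succ_of_monotone hx0 (fun n ↦ hint _ v hv.1)
        fun n ↦ hmono n v hv.1
    obtain ⟨N, hN⟩ := Filter.eventually_atTop.1 hev
    refine ⟨N, fun n hn ↦ ?_⟩
    have heq : ∀ v ∈ V, v (x (n + 1)) = v (x n) := fun v hv ↦ by
      by_cases h1 : v (x 0) = 1
      · have hone (m : ℕ) : v (x m) = 1 := le_antisymm (hint _ v hv)
          (h1 ▸ monotone_nat_of_le_succ (f := fun n ↦ v (x n)) (fun n ↦ hmono n v hv) (Nat.zero_le m))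
        rw [hone, hone]
      · exact hN n hn v ⟨hv, h1⟩
    obtain ⟨u, hu⟩ := (hV (x (n + 1) / x n)).2 fun v hv ↦ by
      rw [map_div₀, heq v hv, div_self ((v.ne_zero_iff).2 (hx0 n))]
    rw [eq_div_iff (hx0 n), ← map_mul] at hu
    rw [← hs n, ← hs (n + 1)]
    exact of_mem_zmultiples_of_dvd (D := D)
      ⟨u, (IsFractionRing.injective D[S] _ hu).symm.trans (mul_comm _ _)⟩

end Monomial

end AddMonoidAlgebra

theorem mainTheorem7 {D S : Type*} [CommRing D] [IsDomain D]
    [AddCommMonoid S] [IsCancelAdd S] [IsAddTorsionFree S] :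
    IsKrullDomain D[S] ↔
      IsKrullDomain D ∧ IsKrullAddMonoid S ∧
        ACCOnCyclicSubgroups (Algebra.GrothendieckAddGroup S) := by
  have := AddMonoidAlgebra.isDomain_of_isAddTorsionFree (D := D) (S := S)
  exact ⟨fun h ↦ ⟨AddMonoidAlgebra.isKrullDomain_base h,
    AddMonoidAlgebra.isKrullAddMonoid_exponents h, AddMonoidAlgebra.accOnCyclicSubgroups h⟩,
    fun h ↦ AddMonoidAlgebra.isKrullDomain h.1 h.2.1 h.2.2⟩
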